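/- Let $N\ge 1$ and let $\Omega=\{\omega_k\}_{k=1}^N$ and $A_0=\{\alpha_{k,0}\}_{k=1}^N$ be two families of complex numbers, each symmetric with respect to the real axis (for $A_0$ the members are counted with multiplicity), such that $\omega_i\neq\omega_k$ for $i\neq k$, $\Re\omega_k>0$ for all $k$, and $\omega_j\neq\pm\alpha_{i,0}$ for all $i,j$. For real $x,t$ put $$\chi_j(x,t)=\omega_j x+\frac{t}{\omega_j}-\frac12\ln\prod_{i=1}^N\left|\frac{\omega_j-\alpha_{i,0}}{\omega_j+\alpha_{i,0}}\right|,\qquad 1\le j\le N,$$ $$\delta_1(x,t)=\det\Big\{\omega_j^{N}\,\frac{\partial^k}{\partial t^k}\cosh\chi_j(x,t)\Big\}_{1\le j\le N,\;0\le k\le N-1},\qquad \delta_2(x,t)=\det\Big\{\omega_j^{N}\,\frac{\partial^k}{\partial t^k}\sinh\chi_j(x,t)\Big\}_{1\le j\le N,\;0\le k\le N-1}.$$ Then the set $U=\{(x,t)\in\mathbb R^2:\ \delta_1(x,t)\neq0,\ \delta_2(x,t)\neq0\}$ is open and dense in $\mathbb R^2$, and the real function $$\xi(x,t)=2\ln\left|\frac{\delta_1(x,t)}{\delta_2(x,t)}\right|$$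 is twice continuously differentiable on $U$ and satisfies there the sinh-Gordon equation $$\frac{\partial^2\xi}{\partial x\,\partial t}=4\sinh\xi .$$ -/

import Mathlib

noncomputable section

/-- A finite family of complex numbers (repetitions allowed) is symmetric with respect to the real
axis: complex conjugation permutes its members. For an injective family this says that the set of
its values is stable under conjugation. -/
def SymmetricAboutRealAxis {N : ℕ} (a : Fin N → ℂ) : Prop :=
  ∃ σ : Equiv.Perm (Fin N), ∀ k, a (σ k) = (starRingEnd ℂ) (a k)

/-- The phase `χ_j(x,t) = ω_j x + t / ω_j - (1/2) ln ∏_i |(ω_j - α_i) / (ω_j + α_i)|`. -/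
def shgPhase {N : ℕ} (ω α : Fin N → ℂ) (j : Fin N) (x t : ℝ) : ℂ :=
  ω j * (x : ℂ) + (t : ℂ) / ω j
    - (((1 / 2 : ℝ) * Real.log (∏ i, ‖(ω j - α i) / (ω j + α i)‖) : ℝ) : ℂ)

/-- `δ₁(x,t) = det (ω_j ^ N ∂_t^k cosh χ_j(x,t))`, with `j`, `k` running over `N` values and the
order of differentiation `k` starting at `0`. -/
def shgDelta₁ {N : ℕ} (ω α : Fin N → ℂ) (x t : ℝ) : ℂ :=
  (Matrix.of fun j k : Fin N =>
    ω j ^ N * iteratedDeriv (k : ℕ) (fun s : ℝ => Complex.cosh (shgPhase ω α j x s)) t).det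

/-- `δ₂(x,t) = det (ω_j ^ N ∂_t^k sinh χ_j(x,t))`. -/
def shgDelta₂ {N : ℕ} (ω α : Fin N → ℂ) (x t : ℝ) : ℂ :=
  (Matrix.of fun j k : Fin N =>
    ω j ^ N * iteratedDeriv (k : ℕ) (fun s : ℝ => Complex.sinh (shgPhase ω α j x s)) t).det

/-- `ξ(x,t) = 2 ln |δ₁(x,t) / δ₂(x,t)|`. -/
def shgXi {N : ℕ} (ω α : Fin N → ℂ) (x t : ℝ) : ℝ :=
  2 * Real.log ‖shgDelta₁ ω α x t / shgDelta₂ ω α x t‖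

/-- The points of the `(x,t)`-plane off the singularity lines `δ₁ = 0` and `δ₂ = 0`. -/
def shgRegularSet {N : ℕ} (ω α : Fin N → ℂ) : Set (ℝ × ℝ) :=
  {p | shgDelta₁ ω α p.1 p.2 ≠ 0 ∧ shgDelta₂ ω α p.1 p.2 ≠ 0}

/-- `φ` is a classical (twice continuously differentiable) solution of the sinh-Gordon equation
`∂²φ/∂x∂t = 4 sinh φ` on the open set `U` of the `(x,t)`-plane. -/
structure IsSinhGordonSolutionOn (φ : ℝ → ℝ → ℝ) (U : Set (ℝ × ℝ)) : Prop where
  isOpen : IsOpen U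
  contDiffOn : ContDiffOn ℝ 2 (fun p : ℝ × ℝ => φ p.1 p.2) U
  equation : ∀ x t : ℝ, (x, t) ∈ U →
    deriv (fun y : ℝ => deriv (fun s : ℝ => φ y s) t) x = 4 * Real.sinh (φ x t)

end

/-!
Write `θ_j = ω_j x + t / ω_j - c_j` and let `W_ε` be the matrix of the `t`-derivatives of order
`0, …, N-1` of the waves `(exp θ_j + ε exp (-θ_j)) / 2`. Up to a common constant factor, `δ₁` and
`δ₂` are `det W_1` and `det W_{-1}`.

Differentiating in `t` shifts the columns of `W_ε` by one, and differentiating in `x` shifts them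
back, because `∂_x ∂_t` acts as the identity on the waves. On the other hand both derivatives flip
the sign of `ε`: with `D = diag ω`, `∂_t W_ε = D⁻¹ W_{-ε}` and `∂_x W_ε = D W_{-ε}`. Let
`B = W_ε⁻¹ D W_{-ε}`, `C = W_ε⁻¹ D⁻¹ W_{-ε}`. By Jacobi's formula `∂_t log (det W_ε) = tr C`, and
since `∂_x (D⁻¹ W_{-ε}) = W_ε`, a further differentiation gives
`∂_x ∂_t log (det W_ε) = N - tr (B C)`. The two opposite shifts make `B C` agree with the identity
in all columns but the last, so `tr (B C) - N = det (B C) - 1`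
(`Matrix.trace_sub_card_eq_det_sub_one`), and `det (B C) = (det W_{-ε} / det W_ε) ^ 2`. Therefore
`∂_x ∂_t log (det W_ε) = 1 - (det W_{-ε} / det W_ε) ^ 2` (`hasDerivAt_waveLogDeriv`).

Subtracting the identities for `ε = 1` and `ε = -1` gives
`∂_x ∂_t ξ = 2 Re (r ^ 2 - r ^ (-2))` with `r = δ₁ / δ₂`. By the symmetry of the data complex
conjugation multiplies `δ₁` and `δ₂` by the same sign (`conj_det_waveMatrix`), so `r` is real and
the right-hand side is `4 sinh (2 log |r|)`.

The regular set is dense because on every line `t = const` the determinants are real-analytic and,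
for large `x`, equal a nonzero factor times a number close to the Vandermonde determinant of the
`ω_j⁻¹` (`eventually_det_waveMatrix_ne_zero`).
-/

open Matrix Filter Topology

/-! ### Differentiation of matrices -/

/-- Jacobi's formula, for a matrix differentiable entry by entry. -/
theorem Matrix.hasDerivAt_det {n : Type*} [Fintype n] [DecidableEq n] {A : ℝ → Matrix n n ℂ}
    {A' : Matrix n n ℂ} {t : ℝ} (hA : ∀ i j, HasDerivAt (fun s => A s i j) (A' i j) t) :
    HasDerivAt (fun s => (A s).det) (((A t).adjugate * A').trace) t := by
  have h1 : HasDerivAt (fun s => (A s).det)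
      (∑ σ : Equiv.Perm n, ((Equiv.Perm.sign σ : ℤ) : ℂ) *
        ∑ i, (∏ j ∈ Finset.univ.erase i, A t (σ j) j) • A' (σ i) i) t := by
    simp only [Matrix.det_apply']
    refine HasDerivAt.fun_sum fun σ _ => HasDerivAt.const_mul _ ?_
    exact HasDerivAt.fun_finsetProd fun i _ => hA (σ i) i
  convert h1 using 1
  have h2 : ∀ i, ((A t).adjugate * A') i i = ((A t).updateCol i (fun j => A' j i)).det := by
    intro i
    rw [← cramer_apply, cramer_eq_adjugate_mulVec]
    rfl
  simp only [trace, diag_apply, h2, det_apply', Finset.mul_sum]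
  rw [Finset.sum_comm]
  refine Finset.sum_congr rfl fun σ _ => Finset.sum_congr rfl fun i _ => ?_
  rw [← Finset.mul_prod_erase _ _ (Finset.mem_univ i), smul_eq_mul, updateCol_self,
    mul_comm (A' _ _)]
  congr 2
  exact Finset.prod_congr rfl fun j hj => updateCol_ne (Finset.ne_of_mem_erase hj)

theorem Matrix.hasDerivAt_mul_apply {n : Type*} [Fintype n] {A B : ℝ → Matrix n n ℂ}
    {A' B' : Matrix n n ℂ} {t : ℝ} (hA : ∀ i j, HasDerivAt (fun s => A s i j) (A' i j) t)
    (hB : ∀ i j, HasDerivAt (fun s => B s i j) (B' i j) t) (i j : n) :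
    HasDerivAt (fun s => (A s * B s) i j) ((A' * B t + A t * B') i j) t := by
  simp only [mul_apply, add_apply, ← Finset.sum_add_distrib]
  exact HasDerivAt.fun_sum fun k _ => (hA i k).mul (hB k j)

/-- The derivative of the inverse matrix is `-A⁻¹ A' A⁻¹`, entry by entry. -/
theorem Matrix.hasDerivAt_inv_apply {n : Type*} [Fintype n] [DecidableEq n]
    {A : ℝ → Matrix n n ℂ} {A' : Matrix n n ℂ} {t : ℝ}
    (hA : ∀ i j, HasDerivAt (fun s => A s i j) (A' i j) t) (h0 : (A t).det ≠ 0) (i j : n) :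
    HasDerivAt (fun s => (A s)⁻¹ i j) (-((A t)⁻¹ * A' * (A t)⁻¹) i j) t := by
  have hdet := hasDerivAt_det hA
  -- Cramer's rule shows that the entries are differentiable; differentiating `A⁻¹ * A = 1` then
  -- determines their derivatives.
  have hd : ∀ i j, DifferentiableAt ℝ (fun s => (A s)⁻¹ i j) t := by
    intro i j
    simp only [inv_def, Ring.inverse_eq_inv', smul_apply, smul_eq_mul, adjugate_apply]
    refine (hdet.differentiableAt.inv h0).mul ?_
    refine (hasDerivAt_det (A' := A'.updateRow j 0) fun k l => ?_).differentiableAt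
    by_cases hk : k = j
    · subst hk
      simpa using hasDerivAt_const t ((Pi.single i 1 : n → ℂ) l)
    · simpa [updateRow_ne hk] using hA k l
  set V' : Matrix n n ℂ := of fun i j => deriv (fun s => (A s)⁻¹ i j) t with hV'
  have hV : ∀ i j, HasDerivAt (fun s => (A s)⁻¹ i j) (V' i j) t := fun i j => (hd i j).hasDerivAt
  have hev : ∀ᶠ s in 𝓝 t, (A s).det ≠ 0 := hdet.continuousAt.eventually_ne h0
  have hu : IsUnit (A t).det := isUnit_iff_ne_zero.2 h0
  have hone : V' * A t + (A t)⁻¹ * A' = 0 := by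
    ext k l
    have h1 := hasDerivAt_mul_apply hV hA k l
    have h2 : HasDerivAt (fun s => ((A s)⁻¹ * A s) k l) 0 t := by
      refine (hasDerivAt_const t ((1 : Matrix n n ℂ) k l)).congr_of_eventuallyEq ?_
      filter_upwards [hev] with s hs
      rw [nonsing_inv_mul _ (isUnit_iff_ne_zero.2 hs)]
    exact h1.unique h2
  have hV'eq : V' = -((A t)⁻¹ * A' * (A t)⁻¹) := by
    rw [← Matrix.mul_one V', ← mul_nonsing_inv _ hu, ← Matrix.mul_assoc,
      eq_neg_of_add_eq_zero_left hone, Matrix.neg_mul]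
  have := hV i j
  rwa [hV'eq] at this

/-- A matrix whose columns, except possibly the last, are those of the identity is a rank one
perturbation `1 + v eᵀ` of it, with `e` the last basis vector. -/
theorem Matrix.trace_sub_card_eq_det_sub_one {N : ℕ} {M : Matrix (Fin N) (Fin N) ℂ}
    (hM : ∀ i k : Fin N, (k : ℕ) + 1 < N → M i k = (1 : Matrix (Fin N) (Fin N) ℂ) i k) :
    M.trace - N = M.det - 1 := by
  rcases N with _ | n
  · simp
  set v : Fin (n + 1) → ℂ := fun i => M i (Fin.last n) - (1 : Matrix _ _ ℂ) i (Fin.last n) with hv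
  have h : M = 1 + replicateCol Unit v *
      replicateRow Unit (Pi.single (Fin.last n) 1 : Fin (n + 1) → ℂ) := by
    ext i k
    by_cases hk : k = Fin.last n
    · subst hk; simp [mul_apply, hv]
    · have : (k : ℕ) + 1 < n + 1 := by
        have := Fin.val_lt_last hk; omega
      simp [mul_apply, hM i k this, hk]
  rw [h, det_one_add_replicateCol_mul_replicateRow, trace_add, trace_mul_comm]
  simp [trace, mul_apply, Pi.single_apply]

/-- For a nonvanishing complex curve, `log |f|` is locally the real part of a logarithm of `f`. -/
theorem HasDerivAt.log_norm {f : ℝ → ℂ} {f' : ℂ} {t : ℝ} (hf : HasDerivAt f f' t) (h0 : f t ≠ 0) :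
    HasDerivAt (fun s => Real.log ‖f s‖) (f' / f t).re t := by
  have h1 := (hf.norm_sq.log (by simpa using h0)).const_mul (1 / 2 : ℝ)
  have h2 : (fun s => Real.log ‖f s‖) = fun s => 1 / 2 * Real.log (‖f s‖ ^ 2) := by
    ext s; rw [Real.log_pow]; push_cast; ring
  rw [h2]
  convert! h1 using 1
  rw [Complex.div_re, Complex.inner, ← Complex.normSq_eq_norm_sq]
  simp
  ring

/-! ### Exponential waves -/

/-- The wave `(e ^ θ + ε e ^ (-θ)) / 2` with phase `θ = w x + t / w - c`: it is `cosh θ` for `ε = 1`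
and `sinh θ` for `ε = -1`. Differentiation in `t` or `x` flips the sign of `ε`, up to the factor
`w⁻¹` or `w`. -/
noncomputable def expWave (w c ε : ℂ) (x t : ℝ) : ℂ :=
  (Complex.exp (w * x + t / w - c) + ε * Complex.exp (-(w * x + t / w - c))) / 2

theorem hasDerivAt_expWave_left (w c ε : ℂ) (x t : ℝ) :
    HasDerivAt (fun y => expWave w c ε y t) (w * expWave w c (-ε) x t) x := by
  have h : HasDerivAt (fun y : ℝ => w * (y : ℂ) + t / w - c) w x := by
    simpa using (((hasDerivAt_id (x : ℂ)).comp_ofReal.const_mul w).add_const (t / w)).sub_const c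
  refine ((h.cexp.add (h.neg.cexp.const_mul ε)).div_const 2).congr_deriv ?_
  simp only [expWave, Pi.neg_apply]
  ring

theorem hasDerivAt_expWave_right (w c ε : ℂ) (x t : ℝ) :
    HasDerivAt (fun s => expWave w c ε x s) (w⁻¹ * expWave w c (-ε) x t) t := by
  have h : HasDerivAt (fun s : ℝ => w * (x : ℂ) + s / w - c) w⁻¹ t := by
    simpa using (((hasDerivAt_id (t : ℂ)).comp_ofReal.div_const w).const_add (w * x)).sub_const c
  refine ((h.cexp.add (h.neg.cexp.const_mul ε)).div_const 2).congr_deriv ?_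
  simp only [expWave, Pi.neg_apply]
  ring

theorem iteratedDeriv_expWave (w c ε : ℂ) (x : ℝ) (k : ℕ) :
    iteratedDeriv k (fun s => expWave w c ε x s) =
      fun s => w⁻¹ ^ k * expWave w c (ε * (-1) ^ k) x s := by
  induction k with
  | zero => simp
  | succ k ih =>
    rw [iteratedDeriv_succ, ih]
    ext s
    rw [((hasDerivAt_expWave_right w c _ x s).const_mul _).deriv]
    ring_nf

theorem conj_expWave (w c ε : ℂ) (x t : ℝ) :
    (starRingEnd ℂ) (expWave w c ε x t) =
      expWave ((starRingEnd ℂ) w) ((starRingEnd ℂ) c) ((starRingEnd ℂ) ε) x t := by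
  simp [expWave, ← Complex.exp_conj, Complex.conj_ofNat]

theorem contDiff_expWave (w c ε : ℂ) (n : WithTop ℕ∞) :
    ContDiff ℝ n (fun p : ℝ × ℝ => expWave w c ε p.1 p.2) := by
  have h1 : ContDiff ℝ n (fun p : ℝ × ℝ => (p.1 : ℂ)) :=
    Complex.ofRealCLM.contDiff.comp contDiff_fst
  have h2 : ContDiff ℝ n (fun p : ℝ × ℝ => (p.2 : ℂ)) :=
    Complex.ofRealCLM.contDiff.comp contDiff_snd
  have h : ContDiff ℝ n (fun p : ℝ × ℝ => w * (p.1 : ℂ) + p.2 / w - c) :=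
    ((contDiff_const.mul h1).add (h2.div_const w)).sub contDiff_const
  exact (h.cexp.add (contDiff_const.mul h.neg.cexp)).div_const 2

/-- As `x → ∞` only the growing exponential of the wave survives, since `0 < re w`. -/
theorem tendsto_expWave {w : ℂ} (hw : 0 < w.re) (c ε : ℂ) (t : ℝ) :
    Tendsto (fun x : ℝ => 2 * Complex.exp (-(w * x + t / w - c)) * expWave w c ε x t)
      atTop (𝓝 1) := by
  have h0 : Tendsto (fun x : ℝ => Complex.exp (-2 * (w * x + t / w - c))) atTop (𝓝 0) := by
    rw [tendsto_zero_iff_norm_tendsto_zero]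
    simp only [Complex.norm_exp]
    refine Real.tendsto_exp_atBot.comp ?_
    have h1 : Tendsto (fun x : ℝ => -2 * w.re * x + -2 * (t / w - c).re) atTop atBot :=
      tendsto_atBot_add_const_right _ _ (tendsto_id.const_mul_atTop_of_neg (by linarith))
    refine h1.congr fun x => ?_
    simp
    ring
  have h2 := (h0.const_mul ε).const_add 1
  rw [mul_zero, add_zero] at h2
  refine h2.congr fun x => ?_
  have e1 : Complex.exp (-2 * (w * x + t / w - c)) =
      Complex.exp (-(w * x + t / w - c)) * Complex.exp (-(w * x + t / w - c)) := by
    rw [← Complex.exp_add]; ring_nf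
  have e2 : Complex.exp (-(w * x + t / w - c)) * Complex.exp (w * x + t / w - c) = 1 := by
    rw [← Complex.exp_add]; simp
  rw [e1, expWave]
  linear_combination -e2

/-! ### The wave matrix and its determinant -/

/-- The matrix with entries `∂_t^k` of `expWave (ω j) (c j) ε`, the derivatives being written out.
For `ε = ±1` its determinant is `δ₁`, respectively `δ₂`, up to the constant `∏ ω_j ^ N`. -/
noncomputable def waveMatrix {N : ℕ} (ω c : Fin N → ℂ) (ε : ℂ) (x t : ℝ) :
    Matrix (Fin N) (Fin N) ℂ :=
  of fun j k => (ω j)⁻¹ ^ (k : ℕ) * expWave (ω j) (c j) (ε * (-1) ^ (k : ℕ)) x t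

section

variable {N : ℕ} {ω c : Fin N → ℂ}

theorem hasDerivAt_waveMatrix_left (ε : ℂ) (x t : ℝ) (j k : Fin N) :
    HasDerivAt (fun y => waveMatrix ω c ε y t j k)
      ((diagonal ω * waveMatrix ω c (-ε) x t) j k) x := by
  refine ((hasDerivAt_expWave_left (ω j) (c j) _ x t).const_mul _).congr_deriv ?_
  simp only [diagonal_mul, waveMatrix, of_apply, neg_mul]
  ring

theorem hasDerivAt_waveMatrix_right (ε : ℂ) (x t : ℝ) (j k : Fin N) :
    HasDerivAt (fun s => waveMatrix ω c ε x s j k)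
      ((diagonal (fun j => (ω j)⁻¹) * waveMatrix ω c (-ε) x t) j k) t := by
  refine ((hasDerivAt_expWave_right (ω j) (c j) _ x t).const_mul _).congr_deriv ?_
  simp only [diagonal_mul, waveMatrix, of_apply, neg_mul]
  ring

/-- `∂_t` shifts the columns of the wave matrix by one to the left: its `k`-th column becomes the
`k+1`-st. -/
theorem diagonal_inv_mul_waveMatrix_apply (ε : ℂ) (x t : ℝ) (j k l : Fin N)
    (hl : (l : ℕ) = k + 1) :
    (diagonal (fun j => (ω j)⁻¹) * waveMatrix ω c (-ε) x t) j k = waveMatrix ω c ε x t j l := by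
  simp only [diagonal_mul, waveMatrix, of_apply, hl, pow_succ]
  ring_nf

/-- `∂_x` is inverse to `∂_t` on the waves, so it shifts the columns one place to the right. -/
theorem diagonal_mul_waveMatrix_apply (hω : ∀ j, ω j ≠ 0) (ε : ℂ) (x t : ℝ) (j k l : Fin N)
    (hl : (l : ℕ) = k + 1) :
    (diagonal ω * waveMatrix ω c (-ε) x t) j l = waveMatrix ω c ε x t j k := by
  simp only [diagonal_mul, waveMatrix, of_apply, hl, pow_succ]
  rw [← mul_assoc, mul_comm (_ ^ _) (ω j)⁻¹, ← mul_assoc, mul_inv_cancel₀ (hω j)]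
  ring_nf

/-- The bilinear identity behind the equation. The matrix `(W⁻¹ ∂_x W) (W⁻¹ ∂_t W)` composes two
opposite column shifts, hence differs from the identity only in its last column. -/
theorem trace_shift_mul_shift (hω : ∀ j, ω j ≠ 0) (ε : ℂ) (x t : ℝ)
    (h0 : (waveMatrix ω c ε x t).det ≠ 0) :
    (((waveMatrix ω c ε x t)⁻¹ * (diagonal ω * waveMatrix ω c (-ε) x t)) *
      ((waveMatrix ω c ε x t)⁻¹ *
        (diagonal (fun j => (ω j)⁻¹) * waveMatrix ω c (-ε) x t))).trace - N =
      ((waveMatrix ω c (-ε) x t).det / (waveMatrix ω c ε x t).det) ^ 2 - 1 := by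
  have hu := nonsing_inv_mul _ (isUnit_iff_ne_zero.2 h0)
  rw [trace_sub_card_eq_det_sub_one]
  · simp only [det_mul, det_diagonal, det_nonsing_inv, Ring.inverse_eq_inv']
    have h : (∏ j, ω j) * ∏ j, (ω j)⁻¹ = 1 := by
      rw [← Finset.prod_mul_distrib]
      exact Finset.prod_eq_one fun j _ => mul_inv_cancel₀ (hω j)
    linear_combination ((waveMatrix ω c ε x t).det⁻¹ * (waveMatrix ω c (-ε) x t).det) ^ 2 * h
  · intro i k hk
    have h1 : ∀ m, ((waveMatrix ω c ε x t)⁻¹ *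
        (diagonal (fun j => (ω j)⁻¹) * waveMatrix ω c (-ε) x t)) m k =
        (1 : Matrix (Fin N) (Fin N) ℂ) m ⟨k + 1, hk⟩ := by
      intro m
      rw [← hu, mul_apply, mul_apply]
      exact Finset.sum_congr rfl fun j _ => by
        rw [diagonal_inv_mul_waveMatrix_apply ε x t j k ⟨k + 1, hk⟩ rfl]
    rw [mul_apply]
    simp only [h1]
    rw [← mul_apply, Matrix.mul_one, ← hu, mul_apply, mul_apply]
    exact Finset.sum_congr rfl fun j _ => by
      rw [diagonal_mul_waveMatrix_apply hω ε x t j k ⟨k + 1, hk⟩ rfl]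

/-- The logarithmic `t`-derivative `tr (W⁻¹ ∂_t W)` of the determinant of the wave matrix. -/
noncomputable def waveLogDeriv (ω c : Fin N → ℂ) (ε : ℂ) (x t : ℝ) : ℂ :=
  ((waveMatrix ω c ε x t)⁻¹ * (diagonal (fun j => (ω j)⁻¹) * waveMatrix ω c (-ε) x t)).trace

theorem hasDerivAt_log_norm_det_waveMatrix (ε : ℂ) (x t : ℝ)
    (h0 : (waveMatrix ω c ε x t).det ≠ 0) :
    HasDerivAt (fun s => Real.log ‖(waveMatrix ω c ε x s).det‖) (waveLogDeriv ω c ε x t).re t := by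
  convert! (hasDerivAt_det
    (hasDerivAt_waveMatrix_right (ω := ω) (c := c) ε x t)).log_norm h0 using 2
  rw [waveLogDeriv, inv_def, Matrix.smul_mul, trace_smul, Ring.inverse_eq_inv', smul_eq_mul,
    div_eq_inv_mul]

/-- `∂_x ∂_t log (det W_ε) = 1 - (det W_{-ε} / det W_ε) ^ 2`. -/
theorem hasDerivAt_waveLogDeriv (hω : ∀ j, ω j ≠ 0) (ε : ℂ) (x t : ℝ)
    (h0 : (waveMatrix ω c ε x t).det ≠ 0) :
    HasDerivAt (fun y => waveLogDeriv ω c ε y t)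
      (1 - ((waveMatrix ω c (-ε) x t).det / (waveMatrix ω c ε x t).det) ^ 2) x := by
  have h1 := hasDerivAt_inv_apply (hasDerivAt_waveMatrix_left (ω := ω) (c := c) ε x t) h0
  have h2 : ∀ i j : Fin N, HasDerivAt
      (fun y => (diagonal (fun j => (ω j)⁻¹) * waveMatrix ω c (-ε) y t) i j)
      (waveMatrix ω c ε x t i j) x := by
    intro i j
    have h := hasDerivAt_waveMatrix_left (ω := ω) (c := c) (-ε) x t i j
    simp only [diagonal_mul, neg_neg] at h ⊢
    simpa [hω i] using h.const_mul (ω i)⁻¹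
  have h3 := HasDerivAt.fun_sum (u := Finset.univ) fun i _ =>
    hasDerivAt_mul_apply (A' := -((waveMatrix ω c ε x t)⁻¹ *
      (diagonal ω * waveMatrix ω c (-ε) x t) * (waveMatrix ω c ε x t)⁻¹)) h1 h2 i i
  refine h3.congr_deriv ?_
  have h4 := trace_shift_mul_shift hω ε x t h0
  have h5 : ∀ M : Matrix (Fin N) (Fin N) ℂ, ∑ i, M i i = M.trace := fun M => rfl
  rw [h5, nonsing_inv_mul _ (isUnit_iff_ne_zero.2 h0), trace_add, trace_one, Matrix.neg_mul,
    trace_neg, Matrix.mul_assoc _ (waveMatrix ω c ε x t)⁻¹, Fintype.card_fin]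
  linear_combination -h4

/-- Conjugation permutes the rows of the wave matrix. The sign of the permutation does not depend on
`ε`, so that the quotient of two such determinants is real. -/
theorem conj_det_waveMatrix {σ : Equiv.Perm (Fin N)}
    (hω : ∀ j, ω (σ j) = (starRingEnd ℂ) (ω j)) (hc : ∀ j, c (σ j) = (starRingEnd ℂ) (c j))
    {ε : ℂ} (hε : (starRingEnd ℂ) ε = ε) (x t : ℝ) :
    (starRingEnd ℂ) (waveMatrix ω c ε x t).det =
      ((Equiv.Perm.sign σ : ℤ) : ℂ) * (waveMatrix ω c ε x t).det := by
  rw [← det_permute, RingHom.map_det]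
  congr 1
  ext j k
  simp [waveMatrix, conj_expWave, hω, hc, hε]

theorem contDiff_det_waveMatrix (ω c : Fin N → ℂ) (ε : ℂ) (n : WithTop ℕ∞) :
    ContDiff ℝ n (fun p : ℝ × ℝ => (waveMatrix ω c ε p.1 p.2).det) := by
  simp only [det_apply']
  exact ContDiff.sum fun σ _ => contDiff_const.mul <| contDiff_prod fun i _ =>
    contDiff_const.mul (contDiff_expWave _ _ _ n)

/-- After division of the rows by the dominant exponentials, the wave matrix tends to the
Vandermonde matrix of the distinct numbers `ω_j⁻¹` as `x → ∞`. -/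
theorem eventually_det_waveMatrix_ne_zero (hinj : Function.Injective ω) (hre : ∀ j, 0 < (ω j).re)
    (ε : ℂ) (t : ℝ) : ∀ᶠ x : ℝ in atTop, (waveMatrix ω c ε x t).det ≠ 0 := by
  set d : ℝ → Fin N → ℂ := fun x j => 2 * Complex.exp (-(ω j * x + t / ω j - c j))
  have hlim : Tendsto (fun x => diagonal (d x) * waveMatrix ω c ε x t) atTop
      (𝓝 (vandermonde fun j => (ω j)⁻¹)) := by
    refine tendsto_pi_nhds.2 fun j => tendsto_pi_nhds.2 fun k => ?_
    have h := (tendsto_expWave (hre j) (c j) (ε * (-1) ^ (k : ℕ)) t).const_mul ((ω j)⁻¹ ^ (k : ℕ))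
    rw [mul_one] at h
    refine h.congr fun x => ?_
    simp only [diagonal_mul, waveMatrix, of_apply, d]
    ring
  have hdet := ((continuous_id.matrix_det).tendsto _).comp hlim
  have hV : (vandermonde fun j => (ω j)⁻¹).det ≠ 0 :=
    det_vandermonde_ne_zero_iff.2 (inv_injective.comp hinj)
  filter_upwards [hdet.eventually_ne hV] with x hx h
  exact hx (by simp [h])

/-- On each line `t = const` the determinant is real-analytic and not identically zero, so its zeros
on that line are isolated. -/
theorem eventually_nhdsNE_det_waveMatrix_ne_zero (hinj : Function.Injective ω)
    (hre : ∀ j, 0 < (ω j).re) (ε : ℂ) (x t : ℝ) :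
    ∀ᶠ y in 𝓝[≠] x, (waveMatrix ω c ε y t).det ≠ 0 := by
  have hdet : ContDiff ℝ ⊤ (fun y : ℝ => (waveMatrix ω c ε y t).det) :=
    (contDiff_det_waveMatrix ω c ε ⊤).comp₂ contDiff_id contDiff_const
  have han : AnalyticOnNhd ℝ (fun y : ℝ => (waveMatrix ω c ε y t).det) Set.univ :=
    hdet.analyticOnNhd
  by_contra hcon
  -- otherwise the determinant vanishes on the whole line, hence also for large abscissae
  have hall := han.eqOn_zero_of_preconnected_of_frequently_eq_zero isPreconnected_univ
    (Set.mem_univ x) ((not_eventually.1 hcon).mono fun y h => not_not.1 h)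
  obtain ⟨y, hy⟩ := (eventually_det_waveMatrix_ne_zero (c := c) hinj hre ε t).exists
  exact hy (hall (Set.mem_univ y))

theorem dense_det_waveMatrix_ne_zero (hinj : Function.Injective ω) (hre : ∀ j, 0 < (ω j).re)
    (ε ε' : ℂ) : Dense {p : ℝ × ℝ | (waveMatrix ω c ε p.1 p.2).det ≠ 0 ∧
      (waveMatrix ω c ε' p.1 p.2).det ≠ 0} := by
  rintro ⟨x, t⟩
  rw [mem_closure_iff_frequently]
  have hlim : Tendsto (fun y : ℝ => (y, t)) (𝓝[≠] x) (𝓝 (x, t)) :=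
    (Continuous.prodMk_left t).continuousAt.mono_left nhdsWithin_le_nhds
  exact hlim.frequently ((eventually_nhdsNE_det_waveMatrix_ne_zero hinj hre ε x t).and
    (eventually_nhdsNE_det_waveMatrix_ne_zero hinj hre ε' x t)).frequently

end

/-! ### The sinh-Gordon equation -/

theorem four_mul_sinh_two_mul_log_norm {r : ℂ} (hr : (starRingEnd ℂ) r = r) (h0 : r ≠ 0) :
    4 * Real.sinh (2 * Real.log ‖r‖) = 2 * ((r ^ 2).re - (r⁻¹ ^ 2).re) := by
  obtain ⟨a, rfl⟩ := Complex.conj_eq_iff_real.1 hr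
  have ha : 0 < |a| := abs_pos.2 (by simpa using h0)
  have h1 : Real.exp (2 * Real.log |a|) = a ^ 2 := by
    rw [two_mul, Real.exp_add, Real.exp_log ha, ← sq, sq_abs]
  have h2 : ((a : ℂ) ^ 2).re = a ^ 2 := by norm_cast
  have h3 : ((a : ℂ)⁻¹ ^ 2).re = (a ^ 2)⁻¹ := by rw [inv_pow]; norm_cast
  rw [Complex.norm_real, Real.norm_eq_abs, Real.sinh_eq, Real.exp_neg, h1, h2, h3]
  ring

/-- The constant `(1/2) ln ∏_i |(ω_j - α_i) / (ω_j + α_i)|` subtracted in the phase `χ_j`, as a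
complex number. -/
noncomputable def shgShift {N : ℕ} (ω α : Fin N → ℂ) (j : Fin N) : ℂ :=
  (((1 / 2 : ℝ) * Real.log (∏ i, ‖(ω j - α i) / (ω j + α i)‖) : ℝ) : ℂ)

theorem shgShift_perm {N : ℕ} {ω α : Fin N → ℂ} {σ : Equiv.Perm (Fin N)}
    (hσ : ∀ j, ω (σ j) = (starRingEnd ℂ) (ω j)) (hα : SymmetricAboutRealAxis α) (j : Fin N) :
    shgShift ω α (σ j) = (starRingEnd ℂ) (shgShift ω α j) := by
  obtain ⟨τ, hτ⟩ := hα
  rw [shgShift, shgShift, Complex.conj_ofReal, ← Equiv.prod_comp τ]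
  congr 4
  ext i
  rw [hτ, hσ, ← map_sub, ← map_add, ← map_div₀, Complex.norm_conj]

theorem cosh_shgPhase {N : ℕ} (ω α : Fin N → ℂ) (j : Fin N) (x t : ℝ) :
    Complex.cosh (shgPhase ω α j x t) = expWave (ω j) (shgShift ω α j) 1 x t := by
  simp only [expWave, one_mul]; rfl

theorem sinh_shgPhase {N : ℕ} (ω α : Fin N → ℂ) (j : Fin N) (x t : ℝ) :
    Complex.sinh (shgPhase ω α j x t) = expWave (ω j) (shgShift ω α j) (-1) x t := by
  simp only [expWave, neg_one_mul, ← sub_eq_add_neg]; rfl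

theorem shgDelta₁_eq {N : ℕ} (ω α : Fin N → ℂ) (x t : ℝ) :
    shgDelta₁ ω α x t = (∏ j, ω j ^ N) * (waveMatrix ω (shgShift ω α) 1 x t).det := by
  rw [← det_mul_column]
  simp only [shgDelta₁, cosh_shgPhase, iteratedDeriv_expWave]
  rfl

theorem shgDelta₂_eq {N : ℕ} (ω α : Fin N → ℂ) (x t : ℝ) :
    shgDelta₂ ω α x t = (∏ j, ω j ^ N) * (waveMatrix ω (shgShift ω α) (-1) x t).det := by
  rw [← det_mul_column]
  simp only [shgDelta₂, sinh_shgPhase, iteratedDeriv_expWave]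
  rfl

theorem theorem3p4 {N : ℕ} (ω α : Fin N → ℂ)
    (hω_inj : Function.Injective ω)
    (hω_re : ∀ k, 0 < (ω k).re)
    (hω_symm : SymmetricAboutRealAxis ω)
    (hα_symm : SymmetricAboutRealAxis α)
    (hα : ∀ j i, ω j ≠ α i ∧ ω j ≠ -α i) :
    Dense (shgRegularSet ω α) ∧
      IsSinhGordonSolutionOn (shgXi ω α) (shgRegularSet ω α) := by
  have hω : ∀ j, ω j ≠ 0 := fun j h => by simpa [h] using hω_re j
  obtain ⟨σ, hσ⟩ := hω_symm
  set c := shgShift ω α with hc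
  set f : ℝ → ℝ → ℂ := fun x t => (waveMatrix ω c 1 x t).det with hf
  set g : ℝ → ℝ → ℂ := fun x t => (waveMatrix ω c (-1) x t).det with hg
  have hprod : (∏ j, ω j ^ N) ≠ 0 := Finset.prod_ne_zero_iff.2 fun j _ => pow_ne_zero _ (hω j)
  have hU : shgRegularSet ω α = {p | f p.1 p.2 ≠ 0 ∧ g p.1 p.2 ≠ 0} := by
    ext p
    simp [shgRegularSet, shgDelta₁_eq, shgDelta₂_eq, hprod, hf, hg, hc]
  have hξ : ∀ x t, f x t ≠ 0 → g x t ≠ 0 →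
      shgXi ω α x t = 2 * (Real.log ‖f x t‖ - Real.log ‖g x t‖) := by
    intro x t h1 h2
    rw [shgXi, shgDelta₁_eq, shgDelta₂_eq, mul_div_mul_left _ _ hprod, norm_div,
      Real.log_div (norm_ne_zero_iff.2 h1) (norm_ne_zero_iff.2 h2)]
  have hcf := contDiff_det_waveMatrix ω c 1 2
  have hcg := contDiff_det_waveMatrix ω c (-1) 2
  have hopen : IsOpen {p : ℝ × ℝ | f p.1 p.2 ≠ 0 ∧ g p.1 p.2 ≠ 0} :=
    (isOpen_ne_fun hcf.continuous continuous_const).inter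
      (isOpen_ne_fun hcg.continuous continuous_const)
  rw [hU]
  refine ⟨dense_det_waveMatrix_ne_zero hω_inj hω_re 1 (-1), hopen, ?_, ?_⟩
  · have h : ContDiffOn ℝ 2 (fun p : ℝ × ℝ => 2 * (Real.log ‖f p.1 p.2‖ - Real.log ‖g p.1 p.2‖))
        {p : ℝ × ℝ | f p.1 p.2 ≠ 0 ∧ g p.1 p.2 ≠ 0} := by
      intro p hp
      refine (contDiffAt_const.mul (ContDiffAt.sub ?_ ?_)).contDiffWithinAt
      · exact (hcf.contDiffAt.norm ℝ hp.1).log (norm_ne_zero_iff.2 hp.1)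
      · exact (hcg.contDiffAt.norm ℝ hp.2).log (norm_ne_zero_iff.2 hp.2)
    exact h.congr fun p hp => hξ _ _ hp.1 hp.2
  · intro x t hxt
    -- the first derivative is needed on a neighbourhood before it can be differentiated in `x`
    have hline : ∀ y s : ℝ, (y, s) ∈ {p : ℝ × ℝ | f p.1 p.2 ≠ 0 ∧ g p.1 p.2 ≠ 0} →
        deriv (fun s => shgXi ω α y s) s =
          2 * ((waveLogDeriv ω c 1 y s).re - (waveLogDeriv ω c (-1) y s).re) := by
      intro y s hys
      have hev : ∀ᶠ s' in 𝓝 s, f y s' ≠ 0 ∧ g y s' ≠ 0 :=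
        (Continuous.prodMk_right y).continuousAt.eventually (hopen.mem_nhds hys)
      refine HasDerivAt.deriv (HasDerivAt.congr_of_eventuallyEq
        (((hasDerivAt_log_norm_det_waveMatrix 1 y s hys.1).sub
          (hasDerivAt_log_norm_det_waveMatrix (-1) y s hys.2)).const_mul 2) ?_)
      filter_upwards [hev] with s' hs'
      exact hξ _ _ hs'.1 hs'.2
    have hev : ∀ᶠ y in 𝓝 x, (y, t) ∈ {p : ℝ × ℝ | f p.1 p.2 ≠ 0 ∧ g p.1 p.2 ≠ 0} :=
      (Continuous.prodMk_left t).continuousAt.eventually (hopen.mem_nhds hxt)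
    have hf' := Complex.reCLM.hasFDerivAt.comp_hasDerivAt x
      (hasDerivAt_waveLogDeriv hω 1 x t hxt.1)
    have hg' := Complex.reCLM.hasFDerivAt.comp_hasDerivAt x
      (hasDerivAt_waveLogDeriv hω (-1) x t hxt.2)
    have hx : deriv (fun y => deriv (fun s => shgXi ω α y s) t) x = _ :=
      (((hf'.sub hg').const_mul 2).congr_of_eventuallyEq
        (hev.mono fun y hy => hline y t hy)).deriv
    have hreal : (starRingEnd ℂ) (f x t / g x t) = f x t / g x t := by
      rw [map_div₀]
      simp only [hf, hg]
      rw [conj_det_waveMatrix hσ (shgShift_perm hσ hα_symm) (by simp),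
        conj_det_waveMatrix hσ (shgShift_perm hσ hα_symm) (by simp), mul_div_mul_left]
      exact_mod_cast (Equiv.Perm.sign σ).ne_zero
    rw [hx, shgXi, shgDelta₁_eq, shgDelta₂_eq, mul_div_mul_left _ _ hprod,
      four_mul_sinh_two_mul_log_norm hreal (div_ne_zero hxt.1 hxt.2), inv_div]
    simp [hf, hg, hc]
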